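/- Let $L_2=\mathbb{Z}_2\wr\mathbb{Z}$ be the lamplighter group, viewed as $\mathbb{Z}\ltimes\mathbb{Z}_2[z^{\pm}]$ with multiplication $(\delta_1,f_1)(\delta_2,f_2)=(\delta_1+\delta_2,\ f_1z^{-\delta_2}+f_2)$ and generators $a=(0,1)$, $t=(1,0)$. Let $w=w(a,t,x)$ be a group word of length $|w|$, with exponent sums $\sigma_t(w)$ and $\sigma_x(w)$ in $t$ and $x$. Write $w=c_0x^{\varepsilon_1}c_1\cdots x^{\varepsilon_k}c_k$ with $c_i=(\delta_i,f_i)\in L_2$ and $\varepsilon_i=\pm1$, and set $\alpha_i=\delta_{i+1}+\dots+\delta_k$, $\beta_i=\varepsilon_{i+1}+\dots+\varepsilon_k$, and $\gamma_i=\beta_i$ if $\varepsilon_i=1$, $\gamma_i=\beta_i-1$ if $\varepsilon_i=-1$. Define the $\delta$-parametric polynomials (finite sums $\sum_i g_i(z)z^{i\delta}$ with $g_i\in\mathbb{Z}_2[z^{\pm}]$) $$\mathrm{num}(w)=\sum_{i=0}^k f_i\,z^{-\alpha_i-\beta_i\delta},\qquad \mathrm{den}(w)=\sum_{i=1}^k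 z^{-\alpha_{i-1}-\gamma_i\delta},$$ and for $\delta\in\mathbb{Z}$ let $\mathrm{num}_\delta(w),\mathrm{den}_\delta(w)\in\mathbb{Z}_2[z^{\pm}]$ be their values at $\delta$. Divisibility is in $\mathbb{Z}_2[z^{\pm}]$, and $0\mid g$ means $g=0$. 1. If $\sigma_x(w)=0$, then the equation $w(a,t,x)=1$ has a solution $x\in L_2$ if and only if $\sigma_t(w)=0$ and $\mathrm{den}_\delta(w)\mid\mathrm{num}_\delta(w)$ for some integer $\delta$ with $|\delta|\le 2^{|w|^2/2}+2|w|^2+3|w|+1$. 2. The test in 1 is algorithmic: there are algorithms that compute $\mathrm{num}(w)$ and $\mathrm{den}(w)$ (as lists of monomials $z^{p+q\delta}$) from $w$, that decide whether $\mathrm{den}_\delta(w)\mid\mathrm{num}_\delta(w)$ for given $w$ and $\delta\in\mathbb{Z}$, and that decide the condition "$\sigma_t(w)=0$ and $\mathrm{den}_\delta(w)\mid\mathrm{num}_\delta(w)$ for some $\delta$ in the above range" for given $w$. 3. There exists an algorithm that, given a one-variable equation $w(a,t,x)=1$ satisfying $\sigma_x(w)=0$, decides whether the equation has a solution in $L_2$.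 4. The Diophantine problem $\mathbf{DP}_1(L_2)$ for all one-variable equations is decidable: there is an algorithm that, given an arbitrary group word $w(a,t,x)$, decides whether there is a group word $s(a,t)$ with $w(a,t,s(a,t))=1$ in $L_2$. -/

import Mathlib

namespace Lamplighter

open LaurentPolynomial

/-- Laurent polynomials over the field with two elements. -/
abbrev Laur : Type := LaurentPolynomial (ZMod 2)

/-- The lamplighter group `ℤ₂ ≀ ℤ`, as the semidirect product of `ℤ` and the finitely supported
functions `ℤ → ℤ₂`. A finitely supported function `f` is written as the Laurent polynomial
`∑ f(i) z^i`. -/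
@[ext]
structure L2 : Type where
  pos : ℤ
  lamps : Laur

/-- The right action of `ℤ` on lamp configurations: `(shift f b)(i) = f(i + b)`. -/
noncomputable def shift (f : Laur) (b : ℤ) : Laur := f * T (-b)

theorem shift_coeff (f : Laur) (b i : ℤ) : (shift f b).coeff i = f.coeff (i + b) := by
  unfold shift T
  have h := AddMonoidAlgebra.coeff_mul_single_apply f (1 : ZMod 2) (-b) i
  simpa using h

theorem shift_shift (f : Laur) (b c : ℤ) : shift (shift f b) c = shift f (b + c) := by
  unfold shift
  rw [mul_T_assoc, neg_add]

theorem shift_add (f g : Laur) (b : ℤ) : shift (f + g) b = shift f b + shift g b := by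
  unfold shift
  rw [add_mul]

theorem shift_neg (f : Laur) (b : ℤ) : shift (-f) b = -shift f b := by
  unfold shift
  rw [neg_mul]

theorem shift_at_zero (f : Laur) : shift f 0 = f := by
  unfold shift
  rw [neg_zero, T_zero, mul_one]

theorem zero_shift (b : ℤ) : shift 0 b = 0 := by
  unfold shift
  rw [zero_mul]

noncomputable instance : Mul L2 := ⟨fun u v => ⟨u.pos + v.pos, shift u.lamps v.pos + v.lamps⟩⟩

noncomputable instance : One L2 := ⟨⟨0, 0⟩⟩

noncomputable instance : Inv L2 := ⟨fun u => ⟨-u.pos, -shift u.lamps (-u.pos)⟩⟩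

theorem mul_def (u v : L2) : u * v = ⟨u.pos + v.pos, shift u.lamps v.pos + v.lamps⟩ := rfl

theorem one_def : (1 : L2) = ⟨0, 0⟩ := rfl

theorem inv_def (u : L2) : u⁻¹ = ⟨-u.pos, -shift u.lamps (-u.pos)⟩ := rfl

noncomputable instance : Group L2 :=
  Group.ofLeftAxioms
    (by
      intro u v w
      simp only [mul_def, L2.mk.injEq, shift_add, shift_shift]
      exact ⟨add_assoc _ _ _, by rw [add_assoc]⟩)
    (by
      intro u
      simp [mul_def, one_def, zero_shift])
    (by
      intro u
      simp [mul_def, one_def, inv_def, shift_neg, shift_shift, shift_at_zero])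

/-- The generator `a = (0, 1₀)`, switching the lamp at the origin. -/
noncomputable def genA : L2 := ⟨0, 1⟩

/-- The generator `t = (1, 0)`. -/
noncomputable def genT : L2 := ⟨1, 0⟩

/-- Group words in the letters `a, t, x`, numbered `0, 1, 2`. The letter `(j, true)` is the
`j`-th letter and `(j, false)` is its inverse. Words need not be reduced. -/
abbrev Word : Type := List (Fin 3 × Bool)

/-- The value in `ℤ₂ ≀ ℤ` of `w(a, t, g)`. -/
noncomputable def eval (w : Word) (g : L2) : L2 :=
  FreeGroup.lift ![genA, genT, g] (FreeGroup.mk w)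

/-- The equation `w(a, t, x) = 1` has a solution in `ℤ₂ ≀ ℤ`. -/
def HasSolution (w : Word) : Prop := ∃ g : L2, eval w g = 1

/-- The Diophantine problem for one-variable equations over `ℤ₂ ≀ ℤ`: is there a group word
`s(a, t)` with `w(a, t, s(a, t)) = 1`? -/
def DP1 (w : Word) : Prop :=
  ∃ s : FreeGroup (Fin 2), eval w (FreeGroup.lift ![genA, genT] s) = 1

/-- The exponent of a letter. -/
def sgn (b : Bool) : ℤ := if b then 1 else -1

/-- The exponent sum of the `j`-th letter in `w`. -/
def expSum (j : Fin 3) (w : Word) : ℤ := (w.map fun l => if l.1 = j then sgn l.2 else 0).sum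

/-- `σ_t(w)`. -/
def sigmaT (w : Word) : ℤ := expSum 1 w

/-- `σ_x(w)`. -/
def sigmaX (w : Word) : ℤ := expSum 2 w

/-- The form `c₀ x^ε₁ c₁ ⋯ x^εₖ cₖ` of a word, with `cᵢ` in `ℤ₂ ≀ ℤ` and `εᵢ = ±1`, recorded as
`(c₀, [(ε₁, c₁), …, (εₖ, cₖ)])`. -/
noncomputable def normalForm : Word → L2 × List (ℤ × L2)
  | [] => (1, [])
  | (j, b) :: w =>
    if j = 2 then (1, (sgn b, (normalForm w).1) :: (normalForm w).2)
    else ((if j = 0 then genA else genT) ^ sgn b * (normalForm w).1, (normalForm w).2)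

/-- The list `[c₀, …, cₖ]`. -/
noncomputable def consts (w : Word) : List L2 :=
  (normalForm w).1 :: (normalForm w).2.map Prod.snd

/-- The list `[ε₁, …, εₖ]`. -/
noncomputable def exps (w : Word) : List ℤ := (normalForm w).2.map Prod.fst

/-- `αᵢ = δᵢ₊₁ + ⋯ + δₖ`, where `cᵢ = (δᵢ, fᵢ)`. -/
noncomputable def alpha (w : Word) (i : ℕ) : ℤ := (((consts w).drop (i + 1)).map L2.pos).sum

/-- `βᵢ = εᵢ₊₁ + ⋯ + εₖ`. -/
noncomputable def beta (w : Word) (i : ℕ) : ℤ := ((exps w).drop i).sum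

/-- `γᵢ = βᵢ` if `εᵢ = 1` and `γᵢ = βᵢ - 1` if `εᵢ = -1`, for `1 ≤ i ≤ k`. -/
noncomputable def gamma (w : Word) (i : ℕ) : ℤ :=
  if (exps w).getD (i - 1) 1 = 1 then beta w i else beta w i - 1

/-- A `δ`-parametric polynomial `∑ fᵢ(z) z^(iδ)`, stored as a Laurent polynomial with
coefficients `fᵢ` in a second indeterminate that stands for `z^δ`. -/
abbrev ParamPoly : Type := LaurentPolynomial Laur

/-- The `δ`-parametric monomial `f(z) z^(iδ)`. -/
noncomputable def monom (f : Laur) (i : ℤ) : ParamPoly := C f * T i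

/-- Instantiation of `∑ fᵢ(z) z^(iδ)` at an integer `δ`. -/
noncomputable def inst (F : ParamPoly) (δ : ℤ) : Laur := F.coeff.sum fun i f => f * T (i * δ)

/-- `num(w) = ∑_{i=0}^k fᵢ z^(-αᵢ - βᵢ δ)`. -/
noncomputable def num (w : Word) : ParamPoly :=
  ∑ i ∈ Finset.range ((exps w).length + 1),
    monom (((consts w).getD i 1).lamps * T (-alpha w i)) (-beta w i)

/-- `den(w) = ∑_{i=1}^k z^(-αᵢ₋₁ - γᵢ δ)`. -/
noncomputable def den (w : Word) : ParamPoly :=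
  ∑ i ∈ Finset.Icc 1 (exps w).length, monom (T (-alpha w (i - 1))) (-gamma w i)

/-- The bound `2^(n²/2) + 2n² + 3n + 1`, with a real exponent. -/
noncomputable def deltaBound (n : ℕ) : ℝ :=
  (2 : ℝ) ^ ((n : ℝ) ^ 2 / 2) + 2 * (n : ℝ) ^ 2 + 3 * (n : ℝ) + 1

/-- The bounded search: `σ_t(w) = 0`, and `den_δ(w)` divides `num_δ(w)` for some integer `δ` with
`|δ| ≤ 2^(|w|²/2) + 2|w|² + 3|w| + 1`. -/
def BoundedTest (w : Word) : Prop :=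
  sigmaT w = 0 ∧
    ∃ δ : ℤ, ((|δ| : ℤ) : ℝ) ≤ deltaBound w.length ∧ inst (den w) δ ∣ inst (num w) δ

/-- The sum `∑ z^(a + bδ)` over a finite list of pairs `(a, b)`. -/
noncomputable def ofList (l : List (ℤ × ℤ)) : ParamPoly :=
  (l.map fun m => monom (T m.1) m.2).sum

end Lamplighter

namespace Lamplighter

open LaurentPolynomial

/-! At x = (δ, f) the word takes the value (σ_t + δσ_x, num_δ + f·den_δ) (`eval_eq`), so solvability
means that some δ satisfies σ_t + δσ_x = 0 and den_δ ∣ num_δ. If σ_x ≠ 0, the first condition gives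
|δ| ≤ |w|. If σ_x = 0, a large δ has to be replaced by a small one (`exists_small_subst_dvd`).

Put y = z^δ. Up to monomials, num and den are polynomials P, S in y over ℤ₂[z], of degree at most m
in z and k in y, where m and k count the letters t^±1 and x^±1. For S ≠ 0, remove its power of y,
which becomes a unit; call the rest U, with leading coefficient c. Pseudo-division gives c^(k+1) P =
QU + R. For δ > (k+3)m the exponents belonging to different powers of y do not overlap, so U_δ ∣ R_δ
forces R = 0: a nonzero multiple of U_δ has at least its spread. Then U_δ ∣ P_δ gives c^(k+1) ∣ Q_δ,
and at any δ this last condition implies U_δ ∣ P_δ. As c^(k+1) divides z^M - 1 for some M ≤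
2^((k+1)m), it depends only on δ mod M. Negative δ are handled by y ↦ y⁻¹, and m + k ≤ |w| turns the
bounds into the stated one.

For computability, num and den are read off letter by letter, and divisibility in ℤ₂[z^±] is a
finite search because the exponents of a quotient are bounded. Solutions given by words s(a, t) are
all solutions, since a and t generate the group. -/

/-- The monomials of `num(w)`, read off along `w`. -/
def numList : Word → List (ℤ × ℤ)
  | [] => []
  | l :: w => if l.1 = 0 then (-sigmaT w, -sigmaX w) :: numList w else numList w

/-- The monomials of `den(w)`, read off along `w`. -/
def denList : Word → List (ℤ × ℤ)
  | [] => []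
  | l :: w =>
    if l.1 = 2 then (-sigmaT w, -(if l.2 then sigmaX w else sigmaX w - 1)) :: denList w
    else denList w

/-! ### Recursion for num and den along the word -/

theorem expSum_cons (j : Fin 3) (l : Fin 3 × Bool) (w : Word) :
    expSum j (l :: w) = (if l.1 = j then sgn l.2 else 0) + expSum j w := by
  simp [expSum]

theorem normalForm_cons_of_eq {j : Fin 3} {b : Bool} (w : Word) (h : j = 2) :
    normalForm ((j, b) :: w) = (1, (sgn b, (normalForm w).1) :: (normalForm w).2) := by
  rw [normalForm, if_pos h]

theorem normalForm_cons_of_ne {j : Fin 3} {b : Bool} (w : Word) (h : j ≠ 2) :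
    normalForm ((j, b) :: w) =
      ((if j = 0 then genA else genT) ^ sgn b * (normalForm w).1, (normalForm w).2) := by
  rw [normalForm, if_neg h]

instance : CharP Laur 2 :=
  CharTwo.of_one_ne_zero_of_two_eq_zero one_ne_zero (by
    rw [← map_ofNat (C : ZMod 2 →+* Laur) 2, show (OfNat.ofNat 2 : ZMod 2) = 0 from rfl, map_zero])

theorem genA_inv : genA⁻¹ = genA := by
  simp only [genA, inv_def, neg_zero, shift_at_zero]
  congr 1
  exact CharTwo.neg_eq 1

theorem genA_zpow_sgn (b : Bool) : genA ^ sgn b = genA := by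
  cases b <;> simp [sgn, genA_inv]

theorem genT_zpow_sgn (b : Bool) : genT ^ sgn b = ⟨sgn b, 0⟩ := by
  cases b <;> simp [sgn, genT, inv_def, zero_shift]

theorem sum_consts_pos (w : Word) : ((consts w).map L2.pos).sum = sigmaT w := by
  induction w with
  | nil => simp [consts, normalForm, sigmaT, expSum, one_def]
  | cons l w ih =>
    obtain ⟨j, b⟩ := l
    simp only [sigmaT, expSum_cons] at ih ⊢
    rw [← ih]
    by_cases h : j = 2
    · subst h
      simp [consts, normalForm_cons_of_eq, one_def]
    · by_cases h0 : j = 0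
      · subst h0
        simp [consts, normalForm_cons_of_ne _ h, genA_zpow_sgn, mul_def]
        simp [genA]
      · have h1 : j = 1 := by omega
        subst h1
        simp [consts, normalForm_cons_of_ne _ h, genT_zpow_sgn, mul_def, add_assoc]

theorem sum_exps (w : Word) : (exps w).sum = sigmaX w := by
  induction w with
  | nil => simp [exps, normalForm, sigmaX, expSum]
  | cons l w ih =>
    obtain ⟨j, b⟩ := l
    simp only [sigmaX, expSum_cons] at ih ⊢
    rw [← ih]
    by_cases h : j = 2
    · subst h
      simp [exps, normalForm_cons_of_eq]
    · simp [exps, normalForm_cons_of_ne _ h, h]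

theorem ofList_nil : ofList [] = 0 := rfl

theorem ofList_cons (m : ℤ × ℤ) (l : List (ℤ × ℤ)) :
    ofList (m :: l) = monom (T m.1) m.2 + ofList l := by
  simp [ofList]

theorem exps_cons_x (b : Bool) (w : Word) : exps ((2, b) :: w) = sgn b :: exps w := by
  simp [exps, normalForm_cons_of_eq]

theorem consts_cons_x (b : Bool) (w : Word) : consts ((2, b) :: w) = 1 :: consts w := by
  simp [consts, normalForm_cons_of_eq]

theorem exps_cons_of_ne {j : Fin 3} (b : Bool) (w : Word) (h : j ≠ 2) :
    exps ((j, b) :: w) = exps w := by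
  simp [exps, normalForm_cons_of_ne _ h]

theorem num_cons_x (b : Bool) (w : Word) : num ((2, b) :: w) = num w := by
  unfold num
  rw [exps_cons_x, List.length_cons, Finset.sum_range_succ']
  simp [alpha, beta, consts_cons_x, exps_cons_x, one_def, monom]

theorem den_cons_x (b : Bool) (w : Word) : den ((2, b) :: w) =
    monom (T (-sigmaT w)) (-(if b then sigmaX w else sigmaX w - 1)) + den w := by
  unfold den
  simp only [← Finset.Ico_add_one_right_eq_Icc, Finset.sum_Ico_eq_sum_range,
    Nat.add_sub_cancel, exps_cons_x, List.length_cons]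
  rw [Finset.sum_range_succ', add_comm]
  congr 1
  · have hb : beta ((2, b) :: w) 1 = sigmaX w := by simp [beta, exps_cons_x, sum_exps]
    have ha : alpha ((2, b) :: w) 0 = sigmaT w := by simp [alpha, consts_cons_x, ← sum_consts_pos]
    cases b <;> simp [gamma, exps_cons_x, hb, ha, sgn]
  · refine Finset.sum_congr rfl fun i _ => ?_
    simp [alpha, beta, gamma, consts_cons_x, exps_cons_x, Nat.add_comm 1]

theorem den_cons_of_ne {j : Fin 3} (b : Bool) (w : Word) (h : j ≠ 2) :
    den ((j, b) :: w) = den w := by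
  unfold den
  rw [exps_cons_of_ne b w h]
  refine Finset.sum_congr rfl fun i _ => ?_
  simp [alpha, beta, gamma, consts, exps_cons_of_ne b w h, normalForm_cons_of_ne _ h]

/-- Only c₀ changes: the lamps of the new letter are shifted by the position of the old c₀, which
completes α₀ to the full sum σ_t(w). -/
theorem num_cons_of_ne {j : Fin 3} (b : Bool) (w : Word) (h : j ≠ 2) :
    num ((j, b) :: w) =
      monom (((if j = 0 then genA else genT) ^ sgn b).lamps * T (-sigmaT w)) (-sigmaX w)
        + num w := by
  have key (f g : Laur) (p q i : ℤ) :
      monom ((shift f p + g) * T (-q)) i = monom (f * T (-(p + q))) i + monom (g * T (-q)) i := by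
    rw [monom, monom, monom, ← add_mul, ← map_add, add_mul, shift, mul_T_assoc, neg_add]
  have hb : beta w 0 = sigmaX w := by simp [beta, sum_exps]
  have ha : (normalForm w).1.pos + alpha w 0 = sigmaT w := by
    simp [alpha, consts, ← sum_consts_pos]
  have ha' (i : ℕ) : alpha ((j, b) :: w) i = alpha w i := by
    simp [alpha, consts, normalForm_cons_of_ne _ h]
  have hb' (i : ℕ) : beta ((j, b) :: w) i = beta w i := by
    simp [beta, exps_cons_of_ne b w h]
  have hc (i : ℕ) : (consts ((j, b) :: w)).getD (i + 1) 1 = (consts w).getD (i + 1) 1 := by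
    simp [consts, normalForm_cons_of_ne _ h]
  have hc0 : (consts ((j, b) :: w)).getD 0 1 =
      (if j = 0 then genA else genT) ^ sgn b * (consts w).getD 0 1 := by
    simp [consts, normalForm_cons_of_ne _ h]
  have hc1 : (consts w).getD 0 1 = (normalForm w).1 := rfl
  simp only [num, exps_cons_of_ne b w h, Finset.sum_range_succ', ha', hb', hc, hc0]
  rw [add_left_comm, mul_def, key, hc1, ha, hb]

theorem ofList_denList (w : Word) : ofList (denList w) = den w := by
  induction w with
  | nil => simp [denList, ofList_nil, den, exps, normalForm]
  | cons l w ih =>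
    obtain ⟨j, b⟩ := l
    by_cases h : j = 2
    · subst h
      rw [den_cons_x, ← ih]
      simp [denList, ofList_cons]
    · rw [den_cons_of_ne b w h, ← ih]
      simp [denList, h]

theorem ofList_numList (w : Word) : ofList (numList w) = num w := by
  induction w with
  | nil => simp [numList, ofList_nil, num, exps, normalForm, consts, one_def, monom]
  | cons l w ih =>
    obtain ⟨j, b⟩ := l
    by_cases h : j = 2
    · subst h
      rw [num_cons_x, ← ih]
      simp [numList]
    · rw [num_cons_of_ne b w h, ← ih]
      by_cases h0 : j = 0
      · subst h0
        rw [if_pos rfl, genA_zpow_sgn]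
        simp [numList, ofList_cons, genA]
      · simp [numList, h0, genT_zpow_sgn, monom]

/-! ### The value of a word at a group element -/

theorem inst_monom (f : Laur) (i δ : ℤ) : inst (monom f i) δ = f * T (i * δ) := by
  rw [monom, ← single_eq_C_mul_T, inst, AddMonoidAlgebra.coeff_single]
  exact Finsupp.sum_single_index (zero_mul _)

theorem inst_add (F G : ParamPoly) (δ : ℤ) : inst (F + G) δ = inst F δ + inst G δ := by
  unfold inst
  rw [AddMonoidAlgebra.coeff_add]
  exact Finsupp.sum_add_index' (by simp) (by intros; ring)

theorem inst_zero (δ : ℤ) : inst 0 δ = 0 := by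
  simp [inst]

theorem inst_ofList (l : List (ℤ × ℤ)) (δ : ℤ) :
    inst (ofList l) δ = (l.map fun m => (T (m.1 + m.2 * δ) : Laur)).sum := by
  induction l with
  | nil => simp [ofList_nil, inst_zero]
  | cons m l ih => rw [ofList_cons, inst_add, inst_monom, ih, ← T_add, List.map_cons, List.sum_cons]

theorem eval_cons (j : Fin 3) (b : Bool) (w : Word) (g : L2) :
    eval ((j, b) :: w) g = (![genA, genT, g] j) ^ sgn b * eval w g := by
  cases b <;> simp [eval, sgn]

theorem zpow_sgn (g : L2) (b : Bool) :
    g ^ sgn b = ⟨sgn b * g.pos, g.lamps * T (if b then 0 else g.pos)⟩ := by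
  cases b <;> simp [sgn, inv_def, shift, CharTwo.neg_eq]

/-- A letter's lamps are shifted by the position of the suffix after it. Since (δ, f)⁻¹ = (-δ, f
z^δ) in characteristic 2, a letter x⁻¹ gets the extra factor z^δ; this is the -1 in γ. -/
theorem eval_eq (w : Word) (g : L2) :
    eval w g = ⟨sigmaT w + g.pos * sigmaX w,
      inst (num w) g.pos + g.lamps * inst (den w) g.pos⟩ := by
  induction w with
  | nil =>
    simp [← ofList_numList, ← ofList_denList, numList, denList, ofList_nil, inst_zero,
      sigmaT, sigmaX, expSum]
    rfl
  | cons l w ih =>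
    obtain ⟨j, b⟩ := l
    rw [eval_cons, ih, mul_def]
    by_cases h : j = 2
    · subst h
      rw [num_cons_x, den_cons_x]
      simp only [Matrix.cons_val, zpow_sgn, sigmaT, sigmaX, expSum_cons, inst_add, inst_monom,
        shift, mul_T_assoc, ← T_add, L2.mk.injEq]
      refine ⟨by simp; ring, ?_⟩
      rw [add_left_comm, mul_add]
      congr 4
      cases b <;> simp <;> ring
    · rw [num_cons_of_ne b w h, den_cons_of_ne b w h, inst_add, inst_monom, mul_T_assoc]
      have hj : ![genA, genT, g] j = if j = 0 then genA else genT := by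
        fin_cases j <;> simp_all
      have hp : (if j = 0 then genA else genT).pos = if j = 1 then 1 else 0 := by
        fin_cases j <;> simp_all [genA, genT]
      rw [hj]
      generalize (if j = 0 then genA else genT) = c at hp
      simp only [sigmaT, sigmaX, expSum_cons, shift, L2.mk.injEq, if_neg h]
      refine ⟨by simp [zpow_sgn, hp]; ring, ?_⟩
      rw [← add_assoc]
      congr 4
      ring

theorem eval_eq_one_iff (w : Word) (g : L2) :
    eval w g = 1 ↔ sigmaT w + g.pos * sigmaX w = 0 ∧
      inst (num w) g.pos = g.lamps * inst (den w) g.pos := by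
  rw [eval_eq, one_def, L2.mk.injEq,
    CharTwo.add_eq_zero (a := inst (num w) g.pos)]

theorem hasSolution_iff (w : Word) :
    HasSolution w ↔ ∃ δ : ℤ, sigmaT w + δ * sigmaX w = 0 ∧ inst (den w) δ ∣ inst (num w) δ := by
  simp only [HasSolution, eval_eq_one_iff]
  constructor
  · rintro ⟨g, h1, h2⟩
    exact ⟨g.pos, h1, Dvd.intro_left _ h2.symm⟩
  · rintro ⟨δ, h1, f, hf⟩
    exact ⟨⟨δ, f⟩, h1, by rw [hf, mul_comm]⟩

/-! ### Generation by a and t -/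

theorem genT_zpow (k : ℤ) : genT ^ k = ⟨k, 0⟩ := by
  induction k with
  | zero => simp [one_def]
  | succ n ih => rw [zpow_add_one, ih]; simp [genT, mul_def, zero_shift]
  | pred n ih => rw [zpow_sub_one, ih]; simp [genT, mul_def, inv_def, zero_shift, sub_eq_add_neg]

theorem closure_genA_genT_eq_top : Subgroup.closure {genA, genT} = (⊤ : Subgroup L2) := by
  rw [eq_top_iff]
  set H := Subgroup.closure {genA, genT}
  have hA : genA ∈ H := Subgroup.subset_closure (by simp)
  have hT (k : ℤ) : genT ^ k ∈ H := H.zpow_mem (Subgroup.subset_closure (by simp)) k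
  have hf (f : Laur) : (⟨0, f⟩ : L2) ∈ H := by
    induction f using LaurentPolynomial.induction_on' with
    | add f g hf hg => simpa [mul_def, shift_at_zero] using H.mul_mem hf hg
    | C_mul_T n a =>
      rcases (by decide : ∀ a : ZMod 2, a = 0 ∨ a = 1) a with rfl | rfl
      · simpa [one_def] using H.one_mem
      -- The conjugate t^n a t^(-n) is (0, z^n).
      · simpa [-zpow_neg, genT_zpow, genA, mul_def, shift] using H.mul_mem (H.mul_mem (hT n) hA) (hT (-n))
  rintro ⟨p, f⟩ -
  simpa [genT_zpow, mul_def, zero_shift] using H.mul_mem (hT p) (hf f)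

theorem lift_genA_genT_surjective :
    Function.Surjective (FreeGroup.lift ![genA, genT] : FreeGroup (Fin 2) →* L2) := by
  rw [← MonoidHom.range_eq_top, FreeGroup.range_lift_eq_closure, ← closure_genA_genT_eq_top]
  congr 1
  simp [Matrix.range_cons, Set.pair_comm]

theorem dp1_iff_hasSolution (w : Word) : DP1 w ↔ HasSolution w :=
  (lift_genA_genT_surjective.exists (p := fun g => eval w g = 1)).symm

/-! ### Spread of Laurent polynomials -/

open Polynomial (X)

theorem coeff_mul_add_ne_zero {f g : Laur} {a b : ℤ} (ha : f.coeff a ≠ 0) (hb : g.coeff b ≠ 0)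
    (h : UniqueAdd f.coeff.support g.coeff.support a b) : (f * g).coeff (a + b) ≠ 0 := by
  rw [AddMonoidAlgebra.coeff_mul_add_of_uniqueAdd h]
  exact mul_ne_zero ha hb

/-- The product of the top terms cannot cancel, so the top exponents add. The next lemma is the
mirror image for bottom exponents. -/
theorem add_le_of_coeff_mul {f g : Laur} {a b B : ℤ} (h : ∀ e, (f * g).coeff e ≠ 0 → e ≤ B)
    (ha : f.coeff a ≠ 0) (hb : g.coeff b ≠ 0) : a + b ≤ B := by
  have ha' := Finsupp.mem_support_iff.mpr ha
  have hb' := Finsupp.mem_support_iff.mpr hb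
  refine (add_le_add (Finset.le_max' _ _ ha') (Finset.le_max' _ _ hb')).trans (h _ ?_)
  refine coeff_mul_add_ne_zero (Finsupp.mem_support_iff.mp (Finset.max'_mem _ _))
    (Finsupp.mem_support_iff.mp (Finset.max'_mem _ _)) fun x y hx hy hxy => ?_
  have := Finset.le_max' _ _ hx
  have := Finset.le_max' _ _ hy
  omega

theorem le_add_of_coeff_mul {f g : Laur} {a b A : ℤ} (h : ∀ e, (f * g).coeff e ≠ 0 → A ≤ e)
    (ha : f.coeff a ≠ 0) (hb : g.coeff b ≠ 0) : A ≤ a + b := by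
  have ha' := Finsupp.mem_support_iff.mpr ha
  have hb' := Finsupp.mem_support_iff.mpr hb
  refine (h _ ?_).trans (add_le_add (Finset.min'_le _ _ ha') (Finset.min'_le _ _ hb'))
  refine coeff_mul_add_ne_zero (Finsupp.mem_support_iff.mp (Finset.min'_mem _ _))
    (Finsupp.mem_support_iff.mp (Finset.min'_mem _ _)) fun x y hx hy hxy => ?_
  have := Finset.min'_le _ _ hx
  have := Finset.min'_le _ _ hy
  omega

theorem exists_coeff_ne_zero {f : Laur} (hf : f ≠ 0) : ∃ a, f.coeff a ≠ 0 := by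
  by_contra! h
  exact hf (LaurentPolynomial.ext h)

/-- A nonzero multiple of `f` has at least the spread of `f`. -/
theorem spread_le_of_dvd {f h : Laur} {a b A B : ℤ} (hfh : f ∣ h) (h0 : h ≠ 0)
    (hh : ∀ e, h.coeff e ≠ 0 → A ≤ e ∧ e ≤ B) (ha : f.coeff a ≠ 0) (hb : f.coeff b ≠ 0) :
    b - a ≤ B - A := by
  obtain ⟨g, rfl⟩ := hfh
  obtain ⟨x, hx⟩ := exists_coeff_ne_zero (right_ne_zero_of_mul h0)
  have := add_le_of_coeff_mul (fun e he => (hh e he).2) hb hx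
  have := le_add_of_coeff_mul (fun e he => (hh e he).1) ha hx
  omega

/-! ### Substituting y = z^δ, and reducing δ -/

/-- Bivariate polynomials `∑ fᵢ(z) y^i`, standing for `δ`-parametric polynomials with `y = z^δ`. -/
abbrev Biv : Type := Polynomial (Polynomial (ZMod 2))

/-- Substitution of `z^δ` for the outer variable. -/
noncomputable def subst (δ : ℤ) : Biv →+* Laur :=
  Polynomial.eval₂RingHom Polynomial.toLaurent (T δ)

theorem subst_X (δ : ℤ) : subst δ X = T δ := by simp [subst]

theorem subst_C (δ : ℤ) (f : Polynomial (ZMod 2)) :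
    subst δ (Polynomial.C f) = Polynomial.toLaurent f := by simp [subst]

theorem coeff_toLaurent_natCast (f : Polynomial (ZMod 2)) (n : ℕ) :
    (Polynomial.toLaurent f).coeff (n : ℤ) = f.coeff n := by
  rw [Polynomial.toLaurent_apply]
  exact Finsupp.mapDomain_apply Nat.cast_injective _ _

theorem exists_of_coeff_toLaurent_ne_zero {f : Polynomial (ZMod 2)} {e : ℤ}
    (h : (Polynomial.toLaurent f).coeff e ≠ 0) : ∃ n : ℕ, e = n ∧ n ≤ f.natDegree := by
  have h' := Finsupp.mem_support_iff.mpr h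
  rw [support_coeff_toLaurent, Finset.mem_map] at h'
  obtain ⟨n, hn, rfl⟩ := h'
  exact ⟨n, rfl, Polynomial.le_natDegree_of_mem_supp n hn⟩

theorem coeff_mul_T (f : Laur) (b i : ℤ) : (f * T b).coeff i = f.coeff (i - b) := by
  simpa [shift, sub_eq_add_neg] using shift_coeff f (-b) i

theorem coeff_subst (δ e : ℤ) (P : Biv) :
    (subst δ P).coeff e =
      ∑ i ∈ Finset.range (P.natDegree + 1), (Polynomial.toLaurent (P.coeff i)).coeff (e - i * δ) := by
  simp only [subst, Polynomial.coe_eval₂RingHom, Polynomial.eval₂_eq_sum_range, T_pow]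
  rw [AddMonoidAlgebra.coeff_sum, Finsupp.finsetSum_apply]
  simp only [coeff_mul_T]

theorem exists_of_coeff_subst_ne_zero {δ e : ℤ} {P : Biv} {A : ℕ}
    (hP : ∀ i, (P.coeff i).natDegree ≤ A) (h : (subst δ P).coeff e ≠ 0) :
    ∃ i j : ℕ, e = i * δ + j ∧ j ≤ A ∧ P.coeff i ≠ 0 := by
  rw [coeff_subst] at h
  obtain ⟨i, -, hi⟩ := Finset.exists_ne_zero_of_sum_ne_zero h
  obtain ⟨j, hj, hj'⟩ := exists_of_coeff_toLaurent_ne_zero hi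
  refine ⟨i, j, by omega, hj'.trans (hP i), ?_⟩
  intro h0
  simp [h0] at hi

/-- The coefficients act as digits in base z^δ: since A < δ, the blocks [iδ, iδ + A] are disjoint
and nothing cancels. -/
theorem coeff_subst_add {δ : ℤ} {P : Biv} {A : ℕ} (hP : ∀ i, (P.coeff i).natDegree ≤ A)
    (hδ : A < δ) (i j : ℕ) (hj : j ≤ A) : (subst δ P).coeff (i * δ + j) = (P.coeff i).coeff j := by
  have key (i' : ℕ) (hi : i' ≠ i) :
      (Polynomial.toLaurent (P.coeff i')).coeff (i * δ + j - i' * δ) = 0 := by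
    by_contra h
    obtain ⟨j', hj', hj''⟩ := exists_of_coeff_toLaurent_ne_zero h
    have := hP i'
    apply hi
    rcases lt_trichotomy i' i with hlt | heq | hlt
    · have : (i' : ℤ) + 1 ≤ i := by exact_mod_cast hlt
      nlinarith
    · exact heq
    · have : (i : ℤ) + 1 ≤ i' := by exact_mod_cast hlt
      nlinarith
  rw [coeff_subst]
  by_cases hi : i < P.natDegree + 1
  · rw [Finset.sum_eq_single i (fun i' _ h => key i' h) (by simp [hi])]
    rw [add_sub_cancel_left, coeff_toLaurent_natCast]
  · rw [Polynomial.coeff_eq_zero_of_natDegree_lt (not_lt.mp hi), Polynomial.coeff_zero]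
    exact Finset.sum_eq_zero fun i' hi' => key i' (by rw [Finset.mem_range] at hi'; omega)

theorem eq_zero_of_subst_eq_zero {δ : ℤ} {P : Biv} {A : ℕ} (hP : ∀ i, (P.coeff i).natDegree ≤ A)
    (hδ : A < δ) (h : subst δ P = 0) : P = 0 := by
  ext i j
  by_cases hj : j ≤ A
  · rw [← coeff_subst_add hP hδ i j hj, h]
    simp
  · rw [Polynomial.coeff_eq_zero_of_natDegree_lt (by have := hP i; omega)]
    simp

/-- Each of the N steps multiplies by the leading coefficient and clears one top coefficient,
raising the inner degree bound by m. Fixing N in advance keeps the bound uniform. -/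
theorem exists_pseudo_division {R : Type*} [CommRing R] (S : Polynomial (Polynomial R)) {m : ℕ}
    (hS : ∀ i, (S.coeff i).natDegree ≤ m) (N : ℕ) :
    ∀ (A : ℕ) (P : Polynomial (Polynomial R)), (∀ i, S.natDegree + N ≤ i → P.coeff i = 0) →
      (∀ i, (P.coeff i).natDegree ≤ A) →
      ∃ Q r : Polynomial (Polynomial R), Polynomial.C (S.leadingCoeff ^ N) * P = Q * S + r ∧
        (∀ i, S.natDegree ≤ i → r.coeff i = 0) ∧ ∀ i, (r.coeff i).natDegree ≤ A + N * m := by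
  induction N with
  | zero => exact fun A P h hA => ⟨0, P, by simp, by simpa using h, by simpa using hA⟩
  | succ N ih =>
    intro A P h hA
    set p := P.coeff (S.natDegree + N)
    obtain ⟨Q, r, hQ, hr, hr'⟩ := ih (A + m)
      (Polynomial.C S.leadingCoeff * P - Polynomial.C p * ((X : Polynomial (Polynomial R)) ^ N * S)) (by
        intro i hi
        simp only [Polynomial.coeff_sub, Polynomial.coeff_C_mul, Polynomial.coeff_X_pow_mul']
        rw [if_pos (by omega)]
        rcases hi.eq_or_lt with rfl | hi
        · simp [p, mul_comm]
        · rw [h i (by omega), Polynomial.coeff_eq_zero_of_natDegree_lt (by omega)]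
          simp) (by
        intro i
        simp only [Polynomial.coeff_sub, Polynomial.coeff_C_mul, Polynomial.coeff_X_pow_mul']
        refine (Polynomial.natDegree_sub_le _ _).trans (max_le ?_ ?_)
        · rw [add_comm A]
          exact Polynomial.natDegree_mul_le_of_le (hS _) (hA _)
        · refine Polynomial.natDegree_mul_le_of_le (hA _) ?_
          split_ifs
          · exact hS _
          · simp)
    refine ⟨Q + Polynomial.C (S.leadingCoeff ^ N) * Polynomial.C p * X ^ N, r, ?_, hr, fun i => ?_⟩
    · rw [add_mul, add_right_comm, ← hQ, pow_succ, Polynomial.C_mul]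
      ring
    · refine (hr' i).trans (le_of_eq ?_)
      ring

/-- Pigeonhole on the 2^deg c remainders modulo c: two powers of z agree, and the smaller one is a
unit among Laurent polynomials, so c may be divisible by z. -/
theorem exists_dvd_T_sub_one {c : Polynomial (ZMod 2)} (hc : c ≠ 0) :
    ∃ M : ℕ, 0 < M ∧ M ≤ 2 ^ c.natDegree ∧ Polynomial.toLaurent c ∣ T (M : ℤ) - 1 := by
  have hm : c.Monic := by
    have h := Polynomial.leadingCoeff_ne_zero.mpr hc
    exact (by decide : ∀ a : ZMod 2, a ≠ 0 → a = 1) _ h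
  obtain ⟨i, i', hne, hii⟩ := Fintype.exists_ne_map_eq_of_card_lt
    (fun (i : Fin (2 ^ c.natDegree + 1)) (j : Fin c.natDegree) =>
      ((X ^ (i : ℕ) : Polynomial (ZMod 2)) %ₘ c).coeff j) (by simp [ZMod.card])
  wlog hlt : i < i' generalizing i i'
  · exact this i' i hne.symm hii.symm (lt_of_le_of_ne (not_lt.mp hlt) hne.symm)
  refine ⟨i' - i, by omega, by omega, ?_⟩
  have hmod : (X ^ (i' : ℕ) : Polynomial (ZMod 2)) %ₘ c = X ^ (i : ℕ) %ₘ c := by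
    ext j
    by_cases hj : j < c.natDegree
    · exact (congrFun hii ⟨j, hj⟩).symm
    · rw [Polynomial.coeff_eq_zero_of_degree_lt, Polynomial.coeff_eq_zero_of_degree_lt]
      all_goals
        refine (Polynomial.degree_modByMonic_lt _ hm).trans_le ?_
        rw [Polynomial.degree_eq_natDegree hc]
        exact_mod_cast not_lt.mp hj
  have hdvd : c ∣ X ^ (i' : ℕ) - X ^ (i : ℕ) := by
    rw [← Polynomial.modByMonic_eq_zero_iff_dvd hm, Polynomial.sub_modByMonic, hmod, sub_self]
  have h := map_dvd Polynomial.toLaurent hdvd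
  rw [map_sub, Polynomial.toLaurent_X_pow, Polynomial.toLaurent_X_pow] at h
  rw [← (isUnit_T (i : ℤ)).dvd_mul_right]
  convert h using 1
  rw [sub_mul, one_mul, ← T_add]
  congr 2
  omega

/-- Modulo z^M - 1, the power z^δ depends only on δ mod M. -/
theorem subst_sub_subst_dvd (Q : Biv) {δ δ' : ℤ} {M : ℕ} (hM : (M : ℤ) ∣ δ - δ') :
    (T (M : ℤ) - 1 : Laur) ∣ subst δ Q - subst δ' Q := by
  have h1 : (T (M : ℤ) - 1 : Laur) ∣ T δ - T δ' := by
    obtain ⟨c, hc⟩ := hM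
    have h2 (n : ℕ) : (T (M : ℤ) - 1 : Laur) ∣ T (M * n) - 1 := by
      have := sub_dvd_pow_sub_pow (T (M : ℤ) : Laur) 1 n
      rwa [T_pow, one_pow, mul_comm (n : ℤ)] at this
    rcases Int.eq_nat_or_neg c with ⟨n, rfl | rfl⟩
    · have : (T δ - T δ' : Laur) = (T (M * n) - 1) * T δ' := by
        rw [sub_mul, ← T_add, one_mul]
        congr 2
        omega
      rw [this]
      exact (h2 n).mul_right _
    · have : (T δ - T δ' : Laur) = -((T (M * n) - 1) * T δ) := by
        rw [sub_mul, ← T_add, one_mul, neg_sub]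
        congr 2
        rw [mul_neg] at hc
        omega
      rw [this]
      exact ((h2 n).mul_right _).neg_right
  simp only [subst, Polynomial.coe_eval₂RingHom, Polynomial.eval₂_eq_eval_map]
  exact h1.trans (Polynomial.sub_dvd_eval_sub _ _ _)

/-- If `S_δ ∣ P_δ` for one large `δ`, then `S_δ' ∣ P_δ'` for one small `δ'`. -/
theorem exists_small_subst_dvd {P S : Biv} {m k : ℕ} (hP : ∀ i, (P.coeff i).natDegree ≤ m)
    (hS : ∀ i, (S.coeff i).natDegree ≤ m) (hPk : P.natDegree ≤ k) {δ : ℤ}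
    (hδ : ((k + 3) * m : ℕ) < δ) (h : subst δ S ∣ subst δ P) :
    ∃ δ' : ℤ, 0 ≤ δ' ∧ δ' < (2 : ℤ) ^ ((k + 1) * m) ∧ subst δ' S ∣ subst δ' P := by
  have hmδ : (m : ℤ) < δ := lt_of_le_of_lt (by push_cast; nlinarith) hδ
  by_cases hS0 : S = 0
  · subst hS0
    rw [map_zero, zero_dvd_iff] at h
    rw [eq_zero_of_subst_eq_zero hP hmδ h]
    exact ⟨0, le_rfl, by positivity, by simp⟩
  -- The power of y in S becomes a unit; U keeps a nonzero constant term in y, which anchors the low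
  -- end of its spread.
  obtain ⟨U, hU, hU0⟩ := Polynomial.exists_eq_pow_rootMultiplicity_mul_and_not_dvd S hS0 0
  rw [Polynomial.C_0, sub_zero] at hU hU0
  set r := Polynomial.rootMultiplicity 0 S
  rw [Polynomial.X_dvd_iff] at hU0
  have hUm (i : ℕ) : (U.coeff i).natDegree ≤ m := by
    have := hS (i + r)
    rwa [hU, Polynomial.coeff_X_pow_mul] at this
  have hdvd (ε : ℤ) : subst ε S ∣ subst ε P ↔ subst ε U ∣ subst ε P := by
    rw [hU, map_mul, map_pow, subst_X, ((isUnit_T ε).pow r).mul_left_dvd]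
  rw [hdvd] at h
  simp only [hdvd]
  have hUne : U ≠ 0 := by rintro rfl; simp at hU0
  obtain ⟨Q, R, hQ, hR, hR'⟩ := exists_pseudo_division U hUm (k + 1) m P
    (fun i hi => Polynomial.coeff_eq_zero_of_natDegree_lt (by omega)) hP
  set c := U.leadingCoeff
  have hc : c ≠ 0 := Polynomial.leadingCoeff_ne_zero.mpr hUne
  have hcN : Polynomial.toLaurent (c ^ (k + 1)) ≠ 0 :=
    Polynomial.toLaurent_ne_zero.mpr (pow_ne_zero _ hc)
  have hQ' (ε : ℤ) : Polynomial.toLaurent (c ^ (k + 1)) * subst ε P =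
      subst ε Q * subst ε U + subst ε R := by
    rw [← map_mul, ← map_add, ← hQ, map_mul, subst_C]
  have hR0 : R = 0 := by
    by_contra hne
    have hRδ : subst δ R ≠ 0 := fun h0 => hne <| eq_zero_of_subst_eq_zero hR'
      (lt_of_le_of_lt (by push_cast; nlinarith) hδ) h0
    have hUR : subst δ U ∣ subst δ R := by
      rw [← dvd_add_right (Dvd.intro_left (subst δ Q) rfl), ← hQ']
      exact h.mul_left _
    obtain ⟨j0, hj0⟩ : ∃ j, (U.coeff 0).coeff j ≠ 0 := by
      by_contra! h0
      exact hU0 (Polynomial.ext h0)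
    have hj0m := (Polynomial.le_natDegree_of_ne_zero hj0).trans (hUm 0)
    have hlo := coeff_subst_add hUm hmδ 0 j0 hj0m
    have hhi := coeff_subst_add hUm hmδ U.natDegree c.natDegree (hUm _)
    rw [← hlo] at hj0
    have hhi0 : (subst δ U).coeff (U.natDegree * δ + c.natDegree) ≠ 0 := by
      rw [hhi]
      exact Polynomial.leadingCoeff_ne_zero.mpr hc
    -- With d = deg U, the spread of U_δ is at least dδ - m, that of R_δ at most (d - 1)δ + (k +
    -- 2)m. Hence δ ≤ (k + 3)m, a contradiction.
    have hspread := spread_le_of_dvd (A := 0) (B := (U.natDegree - 1) * δ + (m + (k + 1) * m : ℕ))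
      hUR hRδ (by
        intro e he
        obtain ⟨i, j, rfl, hj, hi⟩ := exists_of_coeff_subst_ne_zero hR' he
        have hlt : i < U.natDegree := not_le.mp fun hle => hi (hR i hle)
        have h1 : (i : ℤ) ≤ U.natDegree - 1 := by omega
        have h2 : (j : ℤ) ≤ (m + (k + 1) * m : ℕ) := by exact_mod_cast hj
        have h0 : 0 ≤ δ := by omega
        exact ⟨by positivity, add_le_add (mul_le_mul_of_nonneg_right h1 h0) h2⟩) hj0 hhi0
    push_cast at hspread hδ
    have : (j0 : ℤ) ≤ m := by exact_mod_cast hj0m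
    nlinarith
  simp only [hR0, map_zero, add_zero] at hQ'
  have hUδ : subst δ U ≠ 0 := fun h0 => hUne (eq_zero_of_subst_eq_zero hUm hmδ h0)
  have hcQ : Polynomial.toLaurent (c ^ (k + 1)) ∣ subst δ Q := by
    obtain ⟨g, hg⟩ := h
    refine ⟨g, mul_right_cancel₀ hUδ ?_⟩
    rw [← hQ', hg]
    ring
  obtain ⟨M, hM0, hM, hMdvd⟩ := exists_dvd_T_sub_one (pow_ne_zero (k + 1) hc)
  have hM0' : (0 : ℤ) < M := by exact_mod_cast hM0
  -- Q_δ and Q_(δ mod M) agree modulo c^(k+1), so divisibility of Q carries over and yields that of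
  -- P.
  refine ⟨δ % M, Int.emod_nonneg _ hM0'.ne', (Int.emod_lt_of_pos _ hM0').trans_le ?_, ?_⟩
  · have h1 : (c ^ (k + 1)).natDegree ≤ (k + 1) * m :=
      Polynomial.natDegree_pow_le.trans (Nat.mul_le_mul_left _ (hUm _))
    exact_mod_cast hM.trans (Nat.pow_le_pow_right two_pos h1)
  · have h2 := hMdvd.trans (subst_sub_subst_dvd Q (δ := δ) (δ' := δ % M)
      (Int.dvd_self_sub_emod))
    obtain ⟨g, hg⟩ := (dvd_sub_right hcQ).mp h2
    refine ⟨g, mul_left_cancel₀ hcN ?_⟩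
    rw [hQ', hg]
    ring

/-! ### From lists of monomials to bivariate polynomials -/

/-- The bivariate polynomial with the monomials in `l`, moved by `(p, q)`. -/
noncomputable def toBiv (p q : ℤ) (l : List (ℤ × ℤ)) : Biv :=
  (l.map fun e => Polynomial.C (X ^ (e.1 + p).toNat) * X ^ (e.2 + q).toNat).sum

theorem toBiv_cons (p q : ℤ) (e : ℤ × ℤ) (l : List (ℤ × ℤ)) :
    toBiv p q (e :: l) =
      Polynomial.C (X ^ (e.1 + p).toNat) * X ^ (e.2 + q).toNat + toBiv p q l := by
  simp [toBiv]

/-- The exponents in `l`, moved by `(p, q)`, lie in `[0, m] × [0, k]`. -/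
def InBox (p q : ℤ) (m k : ℕ) (l : List (ℤ × ℤ)) : Prop :=
  ∀ e ∈ l, (0 ≤ e.1 + p ∧ e.1 + p ≤ m) ∧ 0 ≤ e.2 + q ∧ e.2 + q ≤ k

section

variable {p q : ℤ} {m k : ℕ} {l : List (ℤ × ℤ)}

theorem subst_toBiv (hl : InBox p q m k l) (δ : ℤ) :
    subst δ (toBiv p q l) = T (p + q * δ) * inst (ofList l) δ := by
  rw [inst_ofList]
  induction l with
  | nil => simp [toBiv]
  | cons e l ih =>
    rw [toBiv_cons, map_add, ih fun e he => hl e (List.mem_cons_of_mem _ he), List.map_cons,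
      List.sum_cons, mul_add]
    congr 1
    obtain ⟨⟨h1, -⟩, h2, -⟩ := hl e List.mem_cons_self
    rw [map_mul, subst_C, map_pow (subst δ), subst_X, Polynomial.toLaurent_X_pow, T_pow, ← T_add, ← T_add,
      Int.toNat_of_nonneg h1, Int.toNat_of_nonneg h2]
    congr 1
    ring

theorem natDegree_toBiv_le (hl : InBox p q m k l) : (toBiv p q l).natDegree ≤ k := by
  induction l with
  | nil => simp [toBiv]
  | cons e l ih =>
    rw [toBiv_cons]
    refine Polynomial.natDegree_add_le_of_degree_le ?_
      (ih fun e he => hl e (List.mem_cons_of_mem _ he))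
    obtain ⟨-, -, h⟩ := hl e List.mem_cons_self
    exact (Polynomial.natDegree_C_mul_X_pow_le _ _).trans (by omega)

theorem natDegree_coeff_toBiv_le (hl : InBox p q m k l) (i : ℕ) :
    ((toBiv p q l).coeff i).natDegree ≤ m := by
  induction l with
  | nil => simp [toBiv]
  | cons e l ih =>
    rw [toBiv_cons, Polynomial.coeff_add]
    refine Polynomial.natDegree_add_le_of_degree_le ?_
      (ih fun e he => hl e (List.mem_cons_of_mem _ he))
    obtain ⟨⟨-, h⟩, -⟩ := hl e List.mem_cons_self
    rw [Polynomial.coeff_C_mul_X_pow]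
    split_ifs
    · rw [Polynomial.natDegree_X_pow]
      omega
    · simp

end

theorem exists_small_inst_dvd_of_lt {p q : ℤ} {m k : ℕ} {N D : List (ℤ × ℤ)}
    (hN : InBox p q m k N) (hD : InBox p q m k D) {δ : ℤ} (hδ : ((k + 3) * m : ℕ) < δ)
    (h : inst (ofList D) δ ∣ inst (ofList N) δ) :
    ∃ δ' : ℤ, 0 ≤ δ' ∧ δ' < (2 : ℤ) ^ ((k + 1) * m) ∧
      inst (ofList D) δ' ∣ inst (ofList N) δ' := by
  have hdvd (ε : ℤ) : subst ε (toBiv p q D) ∣ subst ε (toBiv p q N) ↔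
      inst (ofList D) ε ∣ inst (ofList N) ε := by
    rw [subst_toBiv hN, subst_toBiv hD, (isUnit_T _).mul_left_dvd, (isUnit_T _).dvd_mul_left]
  simp only [← hdvd] at h ⊢
  exact exists_small_subst_dvd (natDegree_coeff_toBiv_le hN) (natDegree_coeff_toBiv_le hD)
    (natDegree_toBiv_le hN) hδ h

/-- The reflection y ↦ y⁻¹ that reduces negative δ to positive δ. -/
theorem inst_ofList_map_neg (l : List (ℤ × ℤ)) (δ : ℤ) :
    inst (ofList (l.map fun e => (e.1, -e.2))) δ = inst (ofList l) (-δ) := by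
  simp [inst_ofList, Function.comp_def]

theorem InBox.map_neg {p q : ℤ} {m k : ℕ} {l : List (ℤ × ℤ)} (hl : InBox p q m k l) :
    InBox p (k - q) m k (l.map fun e => (e.1, -e.2)) := by
  intro e he
  obtain ⟨e', he', rfl⟩ := List.mem_map.mp he
  have := hl e' he'
  exact ⟨this.1, by dsimp only; omega, by dsimp only; omega⟩

theorem exists_small_inst_dvd {p q : ℤ} {m k : ℕ} {N D : List (ℤ × ℤ)}
    (hN : InBox p q m k N) (hD : InBox p q m k D) {δ : ℤ}
    (h : inst (ofList D) δ ∣ inst (ofList N) δ) :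
    ∃ δ' : ℤ, (|δ'| ≤ (k + 3) * m ∨ |δ'| < (2 : ℤ) ^ ((k + 1) * m)) ∧
      inst (ofList D) δ' ∣ inst (ofList N) δ' := by
  by_cases hδ : |δ| ≤ (k + 3) * m
  · exact ⟨δ, Or.inl hδ, h⟩
  rcases le_total 0 δ with h0 | h0
  · rw [abs_of_nonneg h0] at hδ
    obtain ⟨δ', h1, h2, h3⟩ := exists_small_inst_dvd_of_lt hN hD (by push_cast; omega) h
    exact ⟨δ', Or.inr (by rwa [abs_of_nonneg h1]), h3⟩
  · rw [abs_of_nonpos h0] at hδ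
    obtain ⟨δ', h1, h2, h3⟩ := exists_small_inst_dvd_of_lt (δ := -δ) hN.map_neg hD.map_neg
      (by push_cast; omega) (by simpa only [inst_ofList_map_neg, neg_neg] using h)
    refine ⟨-δ', Or.inr (by rwa [abs_neg, abs_of_nonneg h1]), ?_⟩
    simpa only [inst_ofList_map_neg] using h3

/-! ### Bounds in terms of word length -/

theorem neg_count_le_expSum (j : Fin 3) (w : Word) : -(w.count (j, false) : ℤ) ≤ expSum j w := by
  induction w with
  | nil => simp [expSum]
  | cons l w ih =>
    obtain ⟨i, b⟩ := l
    rw [expSum_cons, List.count_cons]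
    cases b <;> by_cases h : i = j <;> simp [h, sgn] <;> omega

theorem expSum_le_count (j : Fin 3) (w : Word) : expSum j w ≤ w.count (j, true) := by
  induction w with
  | nil => simp [expSum]
  | cons l w ih =>
    obtain ⟨i, b⟩ := l
    rw [expSum_cons, List.count_cons]
    cases b <;> by_cases h : i = j <;> simp [h, sgn] <;> omega

/-- The exponents occurring in `num(w)` and `den(w)` are values of the exponent sums on suffixes. -/
theorem exists_suffix_of_mem {w : Word} {e : ℤ × ℤ} (he : e ∈ numList w ++ denList w) :
    ∃ u v : Word, u <:+ w ∧ v <:+ w ∧ e = (-sigmaT u, -sigmaX v) := by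
  induction w with
  | nil => simp [numList, denList] at he
  | cons l w ih =>
    obtain ⟨j, b⟩ := l
    have hw : w <:+ (j, b) :: w := List.suffix_cons _ _
    have lift : (∃ u v : Word, u <:+ w ∧ v <:+ w ∧ e = (-sigmaT u, -sigmaX v)) →
        ∃ u v : Word, u <:+ (j, b) :: w ∧ v <:+ (j, b) :: w ∧ e = (-sigmaT u, -sigmaX v) :=
      fun ⟨u, v, hu, hv, he⟩ => ⟨u, v, hu.trans hw, hv.trans hw, he⟩
    rw [numList, denList] at he
    by_cases h0 : j = 0
    · subst h0
      simp only [if_true, List.cons_append, List.mem_cons] at he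
      rcases he with he | he
      · exact ⟨w, w, hw, hw, he⟩
      · exact lift (ih (by simpa using he))
    by_cases h2 : j = 2
    · subst h2
      simp only [h0, if_false, if_true, List.mem_append, List.mem_cons] at he
      rcases he with he | he | he
      · exact lift (ih (List.mem_append_left _ he))
      · cases b
        -- For x⁻¹, β - 1 is the exponent sum of the suffix that includes this letter.
        · refine ⟨w, _, hw, List.suffix_rfl, ?_⟩
          rw [he]
          simp [sigmaX, expSum_cons, sgn, sub_eq_neg_add]
        · exact ⟨w, w, hw, hw, by simpa using he⟩
      · exact lift (ih (List.mem_append_right _ he))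
    · exact lift (ih (by simpa [h0, h2] using he))

theorem inBox_numList_append_denList (w : Word) :
    InBox (w.count (1, true)) (w.count (2, true)) (w.count (1, true) + w.count (1, false))
      (w.count (2, true) + w.count (2, false)) (numList w ++ denList w) := by
  intro e he
  obtain ⟨u, v, hu, hv, rfl⟩ := exists_suffix_of_mem he
  have h1 := neg_count_le_expSum 1 u
  have h2 := expSum_le_count 1 u
  have h3 := neg_count_le_expSum 2 v
  have h4 := expSum_le_count 2 v
  have h5 := hu.sublist.count_le (1, true)
  have h6 := hu.sublist.count_le (1, false)
  have h7 := hv.sublist.count_le (2, true)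
  have h8 := hv.sublist.count_le (2, false)
  simp only [sigmaT, sigmaX]
  omega

theorem count_add_count_le_length (w : Word) :
    (w.count (1, true) + w.count (1, false)) + (w.count (2, true) + w.count (2, false))
      ≤ w.length := by
  induction w with
  | nil => simp
  | cons l w ih =>
    simp only [List.count_cons, List.length_cons]
    have : ∀ l : Fin 3 × Bool, (if l == (1, true) then 1 else 0) +
      (if l == (1, false) then 1 else 0) + (if l == (2, true) then 1 else 0) +
      (if l == (2, false) then 1 else 0) ≤ 1 := by decide
    have := this l
    omega

theorem le_deltaBound {m k n : ℕ} (h : m + k ≤ n) {d : ℤ}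
    (hd : d ≤ (k + 3) * m ∨ d < (2 : ℤ) ^ ((k + 1) * m)) : (d : ℝ) ≤ deltaBound n := by
  have hpow : (0 : ℝ) < (2 : ℝ) ^ ((n : ℝ) ^ 2 / 2) := by positivity
  have hn : (m : ℝ) + k ≤ n := by exact_mod_cast h
  have hm0 : (0 : ℝ) ≤ m := by positivity
  have hk0 : (0 : ℝ) ≤ k := by positivity
  unfold deltaBound
  rcases hd with hd | hd
  · have : (d : ℝ) ≤ (k + 3) * m := by exact_mod_cast hd
    nlinarith
  -- The only case where 2(k+1)m ≤ (m+k)² fails; there d < 2 suffices.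
  · by_cases hkm : k = 0 ∧ m = 1
    · obtain ⟨rfl, rfl⟩ := hkm
      have : d ≤ 1 := by norm_num at hd; omega
      have : (d : ℝ) ≤ 1 := by exact_mod_cast this
      nlinarith
    have hd' : (d : ℝ) ≤ (2 : ℝ) ^ (((k + 1) * m : ℕ) : ℝ) := by
      rw [Real.rpow_natCast]
      exact_mod_cast hd.le
    have hle : (((k + 1) * m : ℕ) : ℝ) ≤ (n : ℝ) ^ 2 / 2 := by
      have h1 : 2 * ((k + 1) * m) ≤ (m + k) ^ 2 := by
        rcases Nat.eq_zero_or_pos k with rfl | hk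
        · have : m ≠ 1 := fun h => hkm ⟨rfl, h⟩
          rcases Nat.eq_zero_or_pos m with rfl | hm
          · simp
          · have : 2 ≤ m := by omega
            nlinarith
        · zify at hk ⊢
          nlinarith [sq_nonneg ((m : ℤ) - 1)]
      have h2 : (m + k) ^ 2 ≤ n ^ 2 := Nat.pow_le_pow_left h 2
      have h3 : ((2 * ((k + 1) * m) : ℕ) : ℝ) ≤ ((n ^ 2 : ℕ) : ℝ) := by
        exact_mod_cast h1.trans h2
      push_cast at h3 ⊢
      linarith
    have := Real.rpow_le_rpow_of_exponent_le one_le_two hle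
    nlinarith

theorem exists_le_deltaBound {w : Word} {δ : ℤ} (h : inst (den w) δ ∣ inst (num w) δ) :
    ∃ δ' : ℤ, ((|δ'| : ℤ) : ℝ) ≤ deltaBound w.length ∧ inst (den w) δ' ∣ inst (num w) δ' := by
  have hbox := inBox_numList_append_denList w
  rw [← ofList_numList, ← ofList_denList] at h ⊢
  obtain ⟨δ', hδ', hdvd⟩ := exists_small_inst_dvd
    (fun e he => hbox e (List.mem_append_left _ he))
    (fun e he => hbox e (List.mem_append_right _ he)) h
  exact ⟨δ', le_deltaBound (count_add_count_le_length w) hδ', hdvd⟩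

theorem hasSolution_iff_boundedTest {w : Word} (hw : sigmaX w = 0) :
    HasSolution w ↔ BoundedTest w := by
  simp only [hasSolution_iff, BoundedTest, hw, mul_zero, add_zero]
  constructor
  · rintro ⟨δ, h1, h2⟩
    exact ⟨h1, exists_le_deltaBound h2⟩
  · rintro ⟨h1, δ, -, h2⟩
    exact ⟨δ, h1, h2⟩

theorem natCast_length_le_deltaBound (n : ℕ) : (n : ℝ) ≤ deltaBound n := by
  have hpow : (0 : ℝ) < (2 : ℝ) ^ ((n : ℝ) ^ 2 / 2) := by positivity
  have : (0 : ℝ) ≤ n := by positivity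
  unfold deltaBound
  nlinarith

theorem abs_expSum_le_length (j : Fin 3) (w : Word) : |expSum j w| ≤ w.length := by
  have h1 := neg_count_le_expSum j w
  have h2 := expSum_le_count j w
  have h3 := List.count_le_length (a := (j, false)) (l := w)
  have h4 := List.count_le_length (a := (j, true)) (l := w)
  rw [abs_le]
  omega

/-- If σ_x ≠ 0, then |δ| ≤ |σ_t| ≤ |w|, so the same search range serves every word. -/
theorem dp1_iff (w : Word) : DP1 w ↔ ∃ δ : ℤ, ((|δ| : ℤ) : ℝ) ≤ deltaBound w.length ∧
    sigmaT w + δ * sigmaX w = 0 ∧ inst (den w) δ ∣ inst (num w) δ := by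
  rw [dp1_iff_hasSolution, hasSolution_iff]
  constructor
  · rintro ⟨δ, h1, h2⟩
    by_cases hw : sigmaX w = 0
    · obtain ⟨δ', h3, h4⟩ := exists_le_deltaBound h2
      exact ⟨δ', h3, by simpa [hw] using h1, h4⟩
    · refine ⟨δ, le_trans ?_ (natCast_length_le_deltaBound _), h1, h2⟩
      have h3 : |sigmaT w| = |δ| * |sigmaX w| := by
        rw [← abs_mul, eq_neg_of_add_eq_zero_left h1, abs_neg]
      have h4 := abs_expSum_le_length 1 w
      have h5 := Int.one_le_abs hw
      have h6 : |δ| ≤ w.length := by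
        rw [sigmaT] at h3
        nlinarith [abs_nonneg δ]
      exact_mod_cast h6
  · rintro ⟨δ, -, h⟩
    exact ⟨δ, h⟩

end Lamplighter

/-! ### Primitive recursive arithmetic on integers and lists -/

theorem Int.encode_eq_ite (z : ℤ) :
    Encodable.encode z = if 0 ≤ z then 2 * z.toNat else 2 * (-z).toNat - 1 := by
  cases z with
  | ofNat n => exact (if_pos (Int.natCast_nonneg n)).symm
  | negSucc n =>
    rw [if_neg (by omega)]
    change 2 * n + 1 = _
    omega

namespace Primrec

variable {α : Type*} [Primcodable α]

/-- The entry point from ℕ to ℤ: later operations split integers into positive and negative parts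
and return a difference of naturals. -/
theorem int_natCast_sub : Primrec₂ fun a b : ℕ => (a : ℤ) - b := by
  refine Primrec₂.encode_iff.mp (Primrec₂.of_eq (f := fun a b : ℕ =>
    if b ≤ a then 2 * (a - b) else 2 * (b - a) - 1) ?_ fun a b => ?_)
  · refine Primrec.ite (nat_le.comp snd fst) ?_ ?_
    · exact nat_mul.comp (const 2) (nat_sub.comp fst snd)
    · exact nat_sub.comp (nat_mul.comp (const 2) (nat_sub.comp snd fst)) (const 1)
  · rw [Int.encode_eq_ite]
    split_ifs <;> omega

theorem int_toNat : Primrec Int.toNat := by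
  refine Primrec.of_eq (f := fun z : ℤ =>
    if Encodable.encode z % 2 = 0 then Encodable.encode z / 2 else 0) ?_ fun z => ?_
  · exact Primrec.ite (Primrec.eq.comp (nat_mod.comp Primrec.encode (const 2)) (const 0))
      (nat_div.comp Primrec.encode (const 2)) (const 0)
  · rw [Int.encode_eq_ite]
    split_ifs <;> omega

theorem int_toNat_neg : Primrec fun z : ℤ => (-z).toNat := by
  refine Primrec.of_eq (f := fun z : ℤ =>
    if Encodable.encode z % 2 = 0 then 0 else (Encodable.encode z + 1) / 2) ?_ fun z => ?_
  · exact Primrec.ite (Primrec.eq.comp (nat_mod.comp Primrec.encode (const 2)) (const 0))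
      (const 0) (nat_div.comp (succ.comp Primrec.encode) (const 2))
  · rw [Int.encode_eq_ite]
    split_ifs <;> omega

theorem int_natAbs : Primrec Int.natAbs :=
  (nat_add.comp int_toNat int_toNat_neg).of_eq fun z => by omega

theorem int_neg : Primrec fun z : ℤ => -z :=
  (int_natCast_sub.comp int_toNat_neg int_toNat).of_eq fun z => by omega

theorem int_add : Primrec₂ fun a b : ℤ => a + b :=
  (int_natCast_sub.comp
    (nat_add.comp (int_toNat.comp fst) (int_toNat.comp snd))
    (nat_add.comp (int_toNat_neg.comp fst) (int_toNat_neg.comp snd))).of_eq fun z => by dsimp only; omega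

theorem int_sub : Primrec₂ fun a b : ℤ => a - b :=
  (int_add.comp fst (int_neg.comp snd)).of_eq fun _ => (sub_eq_add_neg _ _).symm

theorem int_mul : Primrec₂ fun a b : ℤ => a * b :=
  (int_natCast_sub.comp
    (nat_add.comp (nat_mul.comp (int_toNat.comp fst) (int_toNat.comp snd))
      (nat_mul.comp (int_toNat_neg.comp fst) (int_toNat_neg.comp snd)))
    (nat_add.comp (nat_mul.comp (int_toNat.comp fst) (int_toNat_neg.comp snd))
      (nat_mul.comp (int_toNat_neg.comp fst) (int_toNat.comp snd)))).of_eq fun z => by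
    have h (a : ℤ) : a = a.toNat - (-a).toNat := by omega
    conv_rhs => rw [h z.1, h z.2]
    push_cast
    ring

theorem list_count [DecidableEq α] : Primrec₂ fun (a : α) (l : List α) => l.count a :=
  (list_length.comp ((PrimrecRel.listFilter (Primrec.eq (α := α))).comp snd fst)).of_eq
    fun p => by
      exact List.count_eq_length_filter.symm

theorem list_sublists' : Primrec (List.sublists' : List α → List (List α)) := by
  refine Primrec.of_eq (f := fun l : List α => l.foldr (fun a s => s ++ s.map (List.cons a)) [[]]) ?_ ?_
  · refine list_foldr (α := List α) (β := α) (σ := List (List α))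
      (h := fun _ p => p.2 ++ p.2.map (List.cons p.1)) Primrec.id (const [[]]) ?_
    have hs : Primrec fun p : List α × α × List (List α) => p.2.2 := snd.comp snd
    have hc : Primrec₂ fun (p : List α × α × List (List α)) (l : List α) => p.2.1 :: l :=
      list_cons.comp (fst.comp (snd.comp fst)) snd
    exact list_append.comp hs (list_map hs hc)
  · intro l
    induction l with
    | nil => rfl
    | cons a l ih => rw [List.foldr_cons, ih, List.sublists'_cons]

theorem list_sum_nat : Primrec (List.sum : List ℕ → ℕ) :=
  (list_foldr (h := fun _ p => p.1 + p.2) Primrec.id (const 0)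
    (nat_add.comp (fst.comp snd) (snd.comp snd))).of_eq fun _ => rfl

theorem nat_pow : Primrec₂ fun a b : ℕ => a ^ b :=
  Primrec₂.unpaired'.mp Nat.Primrec.pow

end Primrec

namespace Lamplighter

open LaurentPolynomial

/-! ### Divisibility as a finite search -/

/-- The integers `e` with `|e| ≤ n`. -/
def intRange (n : ℕ) : List ℤ := (List.range (2 * n + 1)).map fun i : ℕ => (i : ℤ) - n

theorem mem_intRange {n : ℕ} {e : ℤ} : e ∈ intRange n ↔ e.natAbs ≤ n := by
  simp only [intRange, List.mem_map, List.mem_range]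
  constructor
  · rintro ⟨i, hi, rfl⟩
    omega
  · intro h
    exact ⟨(e + n).toNat, by omega, by omega⟩

theorem nodup_intRange (n : ℕ) : (intRange n).Nodup :=
  List.nodup_range.map fun i j h => by omega

/-- The Laurent polynomial `∑ z^e`, for a list of exponents. -/
noncomputable def ofExps (l : List ℤ) : Laur := (l.map T).sum

theorem coeff_ofExps (l : List ℤ) (e : ℤ) : (ofExps l).coeff e = (l.count e : ZMod 2) := by
  induction l with
  | nil => simp [ofExps]
  | cons a l ih =>
    rw [ofExps] at ih ⊢
    rw [List.map_cons, List.sum_cons, AddMonoidAlgebra.coeff_add, Finsupp.add_apply, ih, T,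
      AddMonoidAlgebra.coeff_single, Finsupp.single_apply, List.count_cons, add_comm]
    by_cases h : a = e <;> simp [h]

theorem ofExps_eq_zero_iff (l : List ℤ) : ofExps l = 0 ↔ ∀ e ∈ l, l.count e % 2 = 0 := by
  have h2 (n : ℕ) : (n : ZMod 2) = 0 ↔ n % 2 = 0 := by
    rw [ZMod.natCast_eq_zero_iff, Nat.dvd_iff_mod_eq_zero]
  simp only [← h2, ← coeff_ofExps]
  constructor
  · intro h e _
    simp [h]
  · intro h
    refine LaurentPolynomial.ext fun e => ?_
    by_cases he : e ∈ l
    · exact h e he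
    · rw [coeff_ofExps, List.count_eq_zero_of_not_mem he]
      simp

theorem ofExps_append (l l' : List ℤ) : ofExps (l ++ l') = ofExps l + ofExps l' := by
  simp [ofExps]

/-- The exponents of a product. -/
def mulExps (q d : List ℤ) : List ℤ := q.flatMap fun a => d.map fun e => a + e

theorem ofExps_mulExps (q d : List ℤ) : ofExps (mulExps q d) = ofExps q * ofExps d := by
  induction q with
  | nil => simp [mulExps, ofExps]
  | cons a q ih =>
    have h : ofExps (d.map fun e => a + e) = T a * ofExps d := by
      rw [ofExps, ofExps, ← List.sum_map_mul_left, List.map_map]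
      congr 1
      exact List.map_congr_left fun e _ => T_add a e
    rw [mulExps, List.flatMap_cons, ofExps_append, ← mulExps, ih, h]
    simp [ofExps, add_mul]

theorem exists_sublist_ofExps_eq {f : Laur} {n : ℕ} (hf : ∀ e, f.coeff e ≠ 0 → e.natAbs ≤ n) :
    ∃ q ∈ (intRange n).sublists', ofExps q = f := by
  refine ⟨(intRange n).filter fun e => f.coeff e ≠ 0,
    List.mem_sublists'.mpr List.filter_sublist, LaurentPolynomial.ext fun e => ?_⟩
  rw [coeff_ofExps]
  by_cases h : f.coeff e = 0
  · rw [List.count_eq_zero_of_not_mem (by simp [h]), h, Nat.cast_zero]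
  · rw [List.count_filter (by simpa using h),
      List.count_eq_one_of_mem (nodup_intRange n) (mem_intRange.mpr (hf e h)), Nat.cast_one]
    exact ((by decide : ∀ a : ZMod 2, a ≠ 0 → a = 1) _ h).symm

theorem natAbs_le_of_coeff_ofExps {l : List ℤ} {e : ℤ} (h : (ofExps l).coeff e ≠ 0) :
    e.natAbs ≤ (l.map Int.natAbs).sum := by
  refine List.le_sum_of_mem (List.mem_map_of_mem ?_)
  by_contra hne
  exact h (by rw [coeff_ofExps, List.count_eq_zero_of_not_mem hne, Nat.cast_zero])

/-- Exponents of a quotient are bounded by extreme exponents of dividend and divisor. Over ℤ₂ a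
quotient is a set of exponents, hence a sublist of the range. -/
theorem ofExps_dvd_iff (d l : List ℤ) : ofExps d ∣ ofExps l ↔
    ∃ q ∈ (intRange ((d ++ l).map Int.natAbs).sum).sublists', ofExps (l ++ mulExps q d) = 0 := by
  simp only [ofExps_append, ofExps_mulExps, CharTwo.add_eq_zero]
  constructor
  · rintro ⟨g, hg⟩
    -- If the divisor is also zero, g is arbitrary and has no bound; the empty list is used instead.
    by_cases h0 : ofExps l = 0
    · exact ⟨[], by simp, by rw [h0]; simp [ofExps]⟩
    obtain ⟨a, ha⟩ := exists_coeff_ne_zero (left_ne_zero_of_mul (hg ▸ h0))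
    obtain ⟨q, hq, rfl⟩ := exists_sublist_ofExps_eq (f := g)
      (n := ((d ++ l).map Int.natAbs).sum) (by
        intro e he
        have h1 := add_le_of_coeff_mul (B := (l.map Int.natAbs).sum)
          (fun x hx => by have := natAbs_le_of_coeff_ofExps (hg ▸ hx); omega) ha he
        have h2 := le_add_of_coeff_mul (A := -(l.map Int.natAbs).sum)
          (fun x hx => by have := natAbs_le_of_coeff_ofExps (hg ▸ hx); omega) ha he
        have h3 := natAbs_le_of_coeff_ofExps ha
        rw [List.map_append, List.sum_append]
        omega)
    exact ⟨q, hq, by rw [hg, mul_comm]⟩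
  · rintro ⟨q, -, h⟩
    exact ⟨ofExps q, by rw [h, mul_comm]⟩

theorem primrec_intRange : Primrec intRange :=
  Primrec.list_map (Primrec.list_range.comp
      (Primrec.succ.comp (Primrec.nat_mul.comp (Primrec.const 2) Primrec.id)))
    (Primrec.int_natCast_sub.comp Primrec.snd Primrec.fst)

theorem primrec_mulExps : Primrec₂ mulExps :=
  Primrec.list_flatMap Primrec.fst
    (Primrec.list_map (Primrec.snd.comp Primrec.fst)
      (Primrec.int_add.comp (Primrec.snd.comp Primrec.fst) Primrec.snd))

theorem primrecPred_ofExps_eq_zero : PrimrecPred fun l : List ℤ => ofExps l = 0 := by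
  have h : PrimrecRel fun (e : ℤ) (l : List ℤ) => l.count e % 2 = 0 :=
    Primrec.eq.comp (Primrec.nat_mod.comp Primrec.list_count (Primrec.const 2)) (Primrec.const 0)
  exact (h.forall_mem_list.comp Primrec.id Primrec.id).of_eq fun l => (ofExps_eq_zero_iff l).symm

theorem primrecRel_ofExps_dvd : PrimrecRel fun d l : List ℤ => ofExps d ∣ ofExps l := by
  have h : PrimrecRel fun (q : List ℤ) (p : List ℤ × List ℤ) =>
      ofExps (p.2 ++ mulExps q p.1) = 0 :=
    primrecPred_ofExps_eq_zero.comp (Primrec.list_append.comp (Primrec.snd.comp Primrec.snd)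
      (primrec_mulExps.comp Primrec.fst (Primrec.fst.comp Primrec.snd)))
  refine (h.exists_mem_list.comp (Primrec.list_sublists'.comp (primrec_intRange.comp
    (Primrec.list_sum_nat.comp (Primrec.list_map (Primrec.list_append (α := ℤ))
      (Primrec.int_natAbs.comp₂ Primrec₂.right))))) Primrec.id).of_eq fun p => ?_
  exact (ofExps_dvd_iff p.1 p.2).symm

/-! ### Computability of the tests -/

theorem primrec_expSum (j : Fin 3) : Primrec (expSum j) := by
  refine (Primrec.list_foldr (σ := ℤ)
    (h := fun _ p => (if p.1.1 = j then sgn p.1.2 else 0) + p.2) Primrec.id (Primrec.const 0)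
    (Primrec.int_add.comp ?_ (Primrec.snd.comp Primrec.snd))).of_eq fun w => ?_
  · exact (Primrec.dom_finite fun l : Fin 3 × Bool => if l.1 = j then sgn l.2 else 0).comp
      (Primrec.fst.comp Primrec.snd)
  · induction w with
    | nil => rfl
    | cons l w ih => rw [expSum_cons, ← ih]; rfl

theorem primrec_numList : Primrec numList := by
  have hw : Primrec fun p : Word × (Fin 3 × Bool) × Word × List (ℤ × ℤ) => p.2.2.1 :=
    Primrec.fst.comp (Primrec.snd.comp Primrec.snd)
  have hl : Primrec fun p : Word × (Fin 3 × Bool) × Word × List (ℤ × ℤ) => p.2.2.2 :=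
    Primrec.snd.comp (Primrec.snd.comp Primrec.snd)
  refine (Primrec.list_rec (h := fun _ p => if p.1.1 = 0
    then (-sigmaT p.2.1, -sigmaX p.2.1) :: p.2.2 else p.2.2) Primrec.id (Primrec.const [])
    (Primrec.ite (Primrec.eq.comp (Primrec.fst.comp (Primrec.fst.comp Primrec.snd))
      (Primrec.const 0)) (Primrec.list_cons.comp (Primrec.pair
        (Primrec.int_neg.comp ((primrec_expSum 1).comp hw))
        (Primrec.int_neg.comp ((primrec_expSum 2).comp hw))) hl) hl)).of_eq fun w => ?_
  induction w with
  | nil => rfl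
  | cons l w ih => rw [numList, ← ih]; rfl

theorem primrec_denList : Primrec denList := by
  have hj : Primrec fun p : Word × (Fin 3 × Bool) × Word × List (ℤ × ℤ) => p.2.1 :=
    Primrec.fst.comp Primrec.snd
  have hw : Primrec fun p : Word × (Fin 3 × Bool) × Word × List (ℤ × ℤ) => p.2.2.1 :=
    Primrec.fst.comp (Primrec.snd.comp Primrec.snd)
  have hl : Primrec fun p : Word × (Fin 3 × Bool) × Word × List (ℤ × ℤ) => p.2.2.2 :=
    Primrec.snd.comp (Primrec.snd.comp Primrec.snd)
  have hx := (primrec_expSum 2).comp hw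
  refine (Primrec.list_rec (h := fun _ p => if p.1.1 = 2
    then (-sigmaT p.2.1, -(if p.1.2 = true then sigmaX p.2.1 else sigmaX p.2.1 - 1)) :: p.2.2
      else p.2.2) Primrec.id (Primrec.const [])
    (Primrec.ite (Primrec.eq.comp (Primrec.fst.comp hj) (Primrec.const 2))
      (Primrec.list_cons.comp (Primrec.pair
        (Primrec.int_neg.comp ((primrec_expSum 1).comp hw))
        (Primrec.int_neg.comp (Primrec.ite
          (Primrec.eq.comp (Primrec.snd.comp hj) (Primrec.const true)) hx
          (Primrec.int_sub.comp hx (Primrec.const 1))))) hl) hl)).of_eq fun w => ?_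
  induction w with
  | nil => rfl
  | cons l w ih => rw [denList, ← ih]; rfl

theorem primrecPred_inst_den_dvd_inst_num :
    PrimrecPred fun p : Word × ℤ => inst (den p.1) p.2 ∣ inst (num p.1) p.2 := by
  have h {L : Word → List (ℤ × ℤ)} (hL : Primrec L) :
      Primrec fun p : Word × ℤ => (L p.1).map fun e => e.1 + e.2 * p.2 :=
    Primrec.list_map (hL.comp Primrec.fst) (Primrec.int_add.comp (Primrec.fst.comp Primrec.snd)
      (Primrec.int_mul.comp (Primrec.snd.comp Primrec.snd) (Primrec.snd.comp Primrec.fst)))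
  refine (primrecRel_ofExps_dvd.comp (h primrec_denList) (h primrec_numList)).of_eq fun p => ?_
  rw [← ofList_numList, ← ofList_denList, inst_ofList, inst_ofList, ofExps, ofExps, List.map_map,
    List.map_map]
  rfl

/-- The integer part of `deltaBound n`. -/
def natDeltaBound (n : ℕ) : ℕ := Nat.sqrt (2 ^ n ^ 2) + (2 * n ^ 2 + 3 * n + 1)

/-- Since 2^(n²/2) = √(2^(n²)), its integer part is a natural square root, which makes the real
bound computable. -/
theorem le_deltaBound_iff (n : ℕ) (δ : ℤ) :
    ((|δ| : ℤ) : ℝ) ≤ deltaBound n ↔ δ ∈ intRange (natDeltaBound n) := by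
  have h1 : (2 : ℝ) ^ ((n : ℝ) ^ 2 / 2) = √((2 ^ n ^ 2 : ℕ) : ℝ) := by
    rw [Real.sqrt_eq_rpow, Nat.cast_pow, ← Real.rpow_natCast (Nat.cast 2),
      ← Real.rpow_mul (by positivity)]
    congr 1
    push_cast
    ring
  have h2 : deltaBound n = √((2 ^ n ^ 2 : ℕ) : ℝ) + (2 * n ^ 2 + 3 * n + 1 : ℕ) := by
    rw [deltaBound, h1]
    push_cast
    ring
  have h3 : ((|δ| : ℤ) : ℝ) = (δ.natAbs : ℝ) := by
    rw [Int.abs_eq_natAbs, Int.cast_natCast]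
  rw [mem_intRange, natDeltaBound, ← Real.nat_floor_real_sqrt_eq_nat_sqrt,
    ← Nat.floor_add_natCast (Real.sqrt_nonneg _), Nat.le_floor_iff (by positivity), ← h2, h3]

theorem primrec_natDeltaBound : Primrec natDeltaBound := by
  have hsq : Primrec fun n : ℕ => n ^ 2 := Primrec.nat_pow.comp Primrec.id (Primrec.const 2)
  exact Primrec.nat_add.comp
    (Primrec.nat_sqrt.comp (Primrec.nat_pow.comp (Primrec.const 2) hsq))
    (Primrec.succ.comp (Primrec.nat_add.comp (Primrec.nat_mul.comp (Primrec.const 2) hsq)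
      (Primrec.nat_mul.comp (Primrec.const 3) Primrec.id)))

theorem primrecPred_exists_le_deltaBound {R : ℤ → Word → Prop} (hR : PrimrecRel R) :
    PrimrecPred fun w : Word => ∃ δ : ℤ, ((|δ| : ℤ) : ℝ) ≤ deltaBound w.length ∧ R δ w :=
  (hR.exists_mem_list.comp
    (primrec_intRange.comp (primrec_natDeltaBound.comp Primrec.list_length)) Primrec.id).of_eq
    fun w => by simp only [le_deltaBound_iff, id]

theorem primrecRel_inst_den_dvd_inst_num :
    PrimrecRel fun (δ : ℤ) (w : Word) => inst (den w) δ ∣ inst (num w) δ :=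
  PrimrecPred.comp (f := fun p : ℤ × Word => (p.2, p.1)) primrecPred_inst_den_dvd_inst_num
    (Primrec.pair Primrec.snd Primrec.fst)

theorem primrecPred_boundedTest : PrimrecPred BoundedTest := by
  have hT : PrimrecPred fun w : Word => sigmaT w = 0 :=
    Primrec.eq.comp (primrec_expSum 1) (Primrec.const 0)
  exact hT.and (primrecPred_exists_le_deltaBound primrecRel_inst_den_dvd_inst_num)

theorem primrecPred_dp1 : PrimrecPred DP1 := by
  have hT : Primrec fun p : ℤ × Word => sigmaT p.2 := (primrec_expSum 1).comp Primrec.snd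
  have hX : Primrec fun p : ℤ × Word => sigmaX p.2 := (primrec_expSum 2).comp Primrec.snd
  have h0 : PrimrecRel fun (δ : ℤ) (w : Word) => sigmaT w + δ * sigmaX w = 0 :=
    Primrec.eq.comp (Primrec.int_add.comp hT (Primrec.int_mul.comp Primrec.fst hX))
      (Primrec.const 0)
  have h : PrimrecRel fun (δ : ℤ) (w : Word) =>
      sigmaT w + δ * sigmaX w = 0 ∧ inst (den w) δ ∣ inst (num w) δ :=
    PrimrecPred.and h0 primrecRel_inst_den_dvd_inst_num
  exact (primrecPred_exists_le_deltaBound h).of_eq fun w => (dp1_iff w).symm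

end Lamplighter

theorem mainTheorem1 :
    -- the bounded search is correct on every word with `σ_x(w) = 0`
    (∀ w : Lamplighter.Word, Lamplighter.sigmaX w = 0 →
      (Lamplighter.HasSolution w ↔ Lamplighter.BoundedTest w)) ∧
    -- `num(w)` and `den(w)` are computable, as lists of monomials
    (∃ N D : Lamplighter.Word → List (ℤ × ℤ), Computable N ∧ Computable D ∧
      ∀ w : Lamplighter.Word, Lamplighter.ofList (N w) = Lamplighter.num w ∧
        Lamplighter.ofList (D w) = Lamplighter.den w) ∧
    -- each single divisibility test, and the whole bounded search, is computable
    (ComputablePred fun p : Lamplighter.Word × ℤ =>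
      Lamplighter.inst (Lamplighter.den p.1) p.2 ∣ Lamplighter.inst (Lamplighter.num p.1) p.2) ∧
    ComputablePred Lamplighter.BoundedTest ∧
    -- one-variable equations with `σ_x(w) = 0` are decidable
    (∃ decide : Lamplighter.Word → Bool, Computable decide ∧
      ∀ w : Lamplighter.Word, Lamplighter.sigmaX w = 0 →
        (decide w = true ↔ Lamplighter.HasSolution w)) ∧
    -- the Diophantine problem for all one-variable equations is decidable
    ComputablePred Lamplighter.DP1 := by
  have hB := Lamplighter.primrecPred_boundedTest.computablePred
  refine ⟨fun w hw => Lamplighter.hasSolution_iff_boundedTest hw,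
    ⟨_, _, Lamplighter.primrec_numList.to_comp, Lamplighter.primrec_denList.to_comp,
      fun w => ⟨Lamplighter.ofList_numList w, Lamplighter.ofList_denList w⟩⟩,
    Lamplighter.primrecPred_inst_den_dvd_inst_num.computablePred, hB, ?_,
    Lamplighter.primrecPred_dp1.computablePred⟩
  obtain ⟨_, h⟩ := hB
  exact ⟨_, h, fun w hw => by
    rw [decide_eq_true_iff, Lamplighter.hasSolution_iff_boundedTest hw]⟩
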